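/- For $n\ge 0$ let $a_n$ be the number of permutations of $\{1,\dots,n\}$ that avoid the pattern $132$ and all of whose cycles have length $3$ (so $a_0=1$, counting the empty permutation), and let $A^{\{3\}}_{132}(z)=\sum_{n\ge 0}a_nz^n$. Let $c(x)=\sum_{n\ge 0}C_nx^n$ be the generating function of the Catalan numbers, $C_n=\frac{1}{n+1}\binom{2n}{n}$. Let $M_{k,j}$ be the number of Motzkin paths of length $k$ (paths with steps $(1,1)$, $(1,0)$, $(1,-1)$ from $(0,0)$ to $(k,0)$ that never go below the $x$-axis) with exactly $j$ flat steps $(1,0)$ at level zero, and let $m(t,x)=\sum_{k,j\ge 0}M_{k,j}x^kt^j$. **Theorem.** As formal power series in $z$, $$A^{\{3\}}_{132}(z)=1+2\,\bigl(c(z^3)-1\bigr)\,m\bigl(2,\,c(z^3)-1\bigr).$$ Equivalently, the generating function $\sum_{n\ge 1}a_nz^n$ of the nonempty $132$-avoiding permutations composed only of $3$-cycles is $2\,(c(z^3)-1)\,m(2,c(z^3)-1)$. -/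

import Mathlib

namespace PatternCycles

/-! Permutations of `[n]` are `Equiv.Perm (Fin n)`; the one-line notation of `π` is
`π 0, π 1, …, π (n - 1)`. -/

/-- `π` contains the pattern `σ`: the entries of `π` at some increasing sequence of `k` positions
are in the same relative order as `σ`. -/
def Contains {n k : ℕ} (π : Equiv.Perm (Fin n)) (σ : Equiv.Perm (Fin k)) : Prop :=
  ∃ f : Fin k → Fin n, StrictMono f ∧ ∀ a b : Fin k, π (f a) < π (f b) ↔ σ a < σ b

/-- `π` avoids the pattern `σ`. -/
def Avoids {n k : ℕ} (π : Equiv.Perm (Fin n)) (σ : Equiv.Perm (Fin k)) : Prop :=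
  ¬ Contains π σ

/-- The pattern `132`, which in zero-based one-line notation is `0, 2, 1`. -/
def pattern132 : Equiv.Perm (Fin 3) := Equiv.swap 1 2

/-- Every cycle of `π` (fixed points are cycles of length `1`) has its length in `S`. The length of
the cycle through `i` is the minimal period of `i` under `π`. -/
def CycleLengthsIn {n : ℕ} (S : Set ℕ) (π : Equiv.Perm (Fin n)) : Prop :=
  ∀ i : Fin n, Function.minimalPeriod π i ∈ S

/-- The number of permutations of `[n]` that avoid `σ` and have all cycle lengths in `S`. -/
noncomputable def avoidCount (S : Set ℕ) {k : ℕ} (σ : Equiv.Perm (Fin k)) (n : ℕ) : ℕ :=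
  Nat.card {π : Equiv.Perm (Fin n) // CycleLengthsIn S π ∧ Avoids π σ}

/-- The generating function `∑_{n ≥ 0} avoidCount S σ n * z ^ n`. -/
noncomputable def avoidSeries (S : Set ℕ) {k : ℕ} (σ : Equiv.Perm (Fin k)) : PowerSeries ℤ :=
  PowerSeries.mk fun n => (avoidCount S σ n : ℤ)

/-- The steps of a Motzkin path: up `(1, 1)`, flat `(1, 0)`, down `(1, -1)`. -/
inductive Step : Type
  | up
  | flat
  | down
  deriving DecidableEq

instance : Fintype Step :=
  ⟨{.up, .flat, .down}, fun s => by cases s <;> simp⟩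

/-- The change of level along a step. -/
def Step.rise : Step → ℤ
  | .up => 1
  | .flat => 0
  | .down => -1

/-- The level at the end of a path that starts at level `0`. -/
def level (w : List Step) : ℤ := (w.map Step.rise).sum

/-- A Motzkin path starts and ends at level `0` and never goes below level `0`. -/
def IsMotzkinPath (w : List Step) : Prop :=
  (∀ i ≤ w.length, 0 ≤ level (w.take i)) ∧ level w = 0

/-- The number of flat steps of `w` that lie at level `0`. -/
def flatsAtZero (w : List Step) : ℕ :=
  ((Finset.range w.length).filter fun i => w[i]? = some Step.flat ∧ level (w.take i) = 0).card

/-- The set of Motzkin paths of length `k` with `j` flats at level `0`. -/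
def motzkinPaths (k j : ℕ) : Set (List Step) :=
  {w | w.length = k ∧ IsMotzkinPath w ∧ flatsAtZero w = j}

/-- The number `M_{k,j}` of Motzkin paths of length `k` with `j` flats at level `0`. -/
noncomputable def motzkinCount (k j : ℕ) : ℕ := (motzkinPaths k j).ncard

theorem motzkinPaths_finite (k j : ℕ) : (motzkinPaths k j).Finite :=
  (List.finite_length_eq Step k).subset fun _ hw => hw.1

theorem motzkinCount_eq_zero {k j : ℕ} (h : k < j) : motzkinCount k j = 0 := by
  have : motzkinPaths k j = ∅ := by
    ext w
    simp only [motzkinPaths, Set.mem_ofPred_eq, Set.mem_empty_iff_false, iff_false]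
    rintro ⟨hk, -, hj⟩
    have := Finset.card_filter_le (Finset.range w.length)
      fun i => w[i]? = some Step.flat ∧ level (w.take i) = 0
    rw [Finset.card_range] at this
    unfold flatsAtZero at hj
    omega
  rw [motzkinCount, this, Set.ncard_empty]

/-- The generating function `m(t, x) = ∑_{k, j ≥ 0} M_{k,j} x ^ k t ^ j`, as a power series in `x`
over the polynomials in `t`. For each `k` only the `j ≤ k` contribute, because `M_{k,j} = 0` for
`j > k`. -/
noncomputable def motzkinSeries : PowerSeries (Polynomial ℤ) :=
  PowerSeries.mk fun k =>
    ∑ j ∈ Finset.range (k + 1), Polynomial.C (motzkinCount k j : ℤ) * Polynomial.X ^ j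

/-- The power series `m(a, x)` in `x`, for a number `a`. -/
noncomputable def motzkinSeriesAt (a : ℤ) : PowerSeries ℤ :=
  motzkinSeries.map (Polynomial.evalRingHom a)

/-- The Catalan generating function `c(x)`, with integer coefficients. -/
noncomputable def catalanGF : PowerSeries ℤ :=
  PowerSeries.catalanSeries.map (Nat.castRingHom ℤ)

/-- The power series `c(z ^ 3)`. -/
noncomputable def catalanCubed : PowerSeries ℤ :=
  catalanGF.subst (PowerSeries.X ^ 3 : PowerSeries ℤ)

theorem hasSubst_X_pow_three : PowerSeries.HasSubst (PowerSeries.X ^ 3 : PowerSeries ℤ) :=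
  PowerSeries.HasSubst.X_pow (by norm_num)

/-- `c(z ^ 3) - 1` has constant coefficient `0`, so that it may be substituted into any power
series. -/
theorem hasSubst_catalanCubed_sub_one : PowerSeries.HasSubst (catalanCubed - 1) := by
  apply PowerSeries.HasSubst.of_constantCoeff_zero'
  rw [map_sub, map_one, catalanCubed, PowerSeries.constantCoeff_subst_X_pow (by norm_num)]
  simp [catalanGF, ← PowerSeries.coeff_zero_eq_constantCoeff_apply, PowerSeries.coeff_map]

end PatternCycles

/-! Let `π` avoid `132` and have only `3`-cycles, on `3m` points. The cycle minima are then the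
first `m` points (`isLowerSet_cycleMinima`). Let `s` and `t` enumerate in increasing order their
images and the remaining points; avoidance forces `π (s i) = t i`. So `π` amounts to the set of
values of `s` and a permutation `τ` of `[m]` that describes how `t` returns to the minima
(`exists_layoutPerm_eq`, `layoutPerm_injective`).

Such a `π` avoids `132` iff `τ` does and `s`, `t` interleave suitably
(`ThreeCycleLayout.avoids_iff`). Let `g i` be the number of `t`'s below `s i`, and cut `[m]` into
blocks that end at the right-to-left maxima of `τ`. The condition says that the monotone map `g` is
constant on blocks and takes block boundaries as values (`avoids_layoutPerm_iff`). With `k` blocks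
there are `k + 1` boundaries, hence `(2k).choose k` choices. Inserting a maximum shows that the
avoiders `τ` with `k` right-to-left maxima obey the ballot recursion, so they are counted by the
coefficient of `x^m` in `(x c)^k`. With `B = ∑ (2n).choose n * x^n`, the generating function is
therefore `B(x c(x))` at `x = z^3`.

It remains to compare series. Here `B = c / (2 - c)`. Put `u = c - 1` and `N = c(x c(x)) - 1`. Then
`N = u (1 + N + N^2)`, which is the Motzkin equation, so that `m(a, u) = 1 / (1 - a u - u N)`;
eliminating `N` gives `centralBinomSeries_subst`. -/

namespace PatternCycles
open PowerSeries

/-! ### Motzkin paths and the series `m(a, x)` -/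

/-- The words of length `k` in the three steps. -/
def stepWords : ℕ → Finset (List Step)
  | 0 => {[]}
  | k + 1 => (stepWords k).image (Step.up :: ·) ∪ (stepWords k).image (Step.flat :: ·) ∪
      (stepWords k).image (Step.down :: ·)

theorem mem_stepWords {k : ℕ} {w : List Step} : w ∈ stepWords k ↔ w.length = k := by
  induction k generalizing w with
  | zero => simp [stepWords]
  | succ k ih =>
    cases w with
    | nil => simp [stepWords]
    | cons s w => cases s <;> simp [stepWords, ih]

theorem sum_stepWords_succ {M : Type*} [AddCommMonoid M] (k : ℕ) (f : List Step → M) :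
    ∑ w ∈ stepWords (k + 1), f w =
      ∑ w ∈ stepWords k, f (Step.up :: w) + ∑ w ∈ stepWords k, f (Step.flat :: w) +
        ∑ w ∈ stepWords k, f (Step.down :: w) := by
  rw [stepWords, Finset.sum_union, Finset.sum_union, Finset.sum_image, Finset.sum_image,
    Finset.sum_image]
  · simp
  · simp
  · simp
  · rw [Finset.disjoint_left]; simp
  · rw [Finset.disjoint_left]; aesop

/-- The weight `a ^ j` of a path from level `h` to level `0` that stays weakly above level `0` and
has `j` flats at level `0`; all other words have weight `0`. -/
def pathWeight (a : ℤ) : List Step → ℕ → ℤ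
  | [], h => if h = 0 then 1 else 0
  | .up :: w, h => pathWeight a w (h + 1)
  | .flat :: w, h => (if h = 0 then a else 1) * pathWeight a w h
  | .down :: _, 0 => 0
  | .down :: w, h + 1 => pathWeight a w h

theorem level_cons (s : Step) (w : List Step) : level (s :: w) = s.rise + level w := by
  simp [level]

/-- The flats at level zero of the path that follows `w` from level `h`. -/
def flatsAtZeroFrom (h : ℤ) (w : List Step) : ℕ :=
  ((Finset.range w.length).filter fun i => w[i]? = some Step.flat ∧ h + level (w.take i) = 0).card

/-- The path that follows `w` from level `h` stays weakly above level `0` and ends there. -/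
def IsMotzkinFrom (h : ℤ) (w : List Step) : Prop :=
  (∀ i ≤ w.length, 0 ≤ h + level (w.take i)) ∧ h + level w = 0

theorem isMotzkinFrom_cons (h : ℤ) (s : Step) (w : List Step) :
    IsMotzkinFrom h (s :: w) ↔ 0 ≤ h ∧ IsMotzkinFrom (h + s.rise) w := by
  unfold IsMotzkinFrom
  constructor
  · rintro ⟨h1, h2⟩
    refine ⟨by simpa [level] using h1 0 (by simp), fun i hi => ?_, ?_⟩
    · have := h1 (i + 1) (by simpa using hi)
      rw [List.take_succ_cons, level_cons] at this
      linarith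
    · rw [level_cons] at h2; linarith
  · rintro ⟨h0, h1, h2⟩
    refine ⟨fun i hi => ?_, ?_⟩
    · cases i with
      | zero => simpa [level] using h0
      | succ i =>
        have := h1 i (by simpa using hi)
        rw [List.take_succ_cons, level_cons]
        linarith
    · rw [level_cons]; linarith

theorem flatsAtZeroFrom_cons (h : ℤ) (s : Step) (w : List Step) :
    flatsAtZeroFrom h (s :: w) =
      (if s = Step.flat ∧ h = 0 then 1 else 0) + flatsAtZeroFrom (h + s.rise) w := by
  unfold flatsAtZeroFrom
  rw [List.length_cons, Finset.card_filter, Finset.sum_range_succ', Finset.card_filter, add_comm]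
  congr 1
  · simp [level]
  · refine Finset.sum_congr rfl fun i _ => ?_
    simp [level_cons, add_assoc]

-- An arbitrary starting level `h` is what lets the induction remove the first step; only `h = 0` is
-- needed later.
open Classical in
theorem pathWeight_eq (a : ℤ) (w : List Step) (h : ℕ) :
    pathWeight a w h = if IsMotzkinFrom h w then a ^ flatsAtZeroFrom h w else 0 := by
  induction w generalizing h with
  | nil =>
    by_cases hh : h = 0 <;> simp [pathWeight, IsMotzkinFrom, flatsAtZeroFrom, level, hh]
  | cons s w ih =>
    rw [isMotzkinFrom_cons, flatsAtZeroFrom_cons]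
    cases s with
    | up => simp [pathWeight, ih, Step.rise]
    | flat =>
      simp only [pathWeight, ih, Step.rise]
      by_cases hh : h = 0 <;> simp [hh, pow_add]
    | down =>
      cases h with
      | zero =>
        have : ¬ IsMotzkinFrom (-1) w := fun hw => by
          have := hw.1 0 (by simp)
          simp [level] at this
        simp [pathWeight, Step.rise, this]
      | succ h =>
        have : (0 : ℤ) ≤ h + 1 := by positivity
        simp [pathWeight, ih, Step.rise, this]

/-- The generating function of weighted paths from level `h` to level `0`. -/
noncomputable def pathSeries (a : ℤ) (h : ℕ) : PowerSeries ℤ :=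
  PowerSeries.mk fun k => ∑ w ∈ stepWords k, pathWeight a w h

/-- Decomposition by the first step. Together with `pathSeries_succ` it gives an infinite linear
system in `h`, solved in `motzkinSeriesAt_subst`. -/
theorem pathSeries_zero (a : ℤ) :
    pathSeries a 0 = 1 + X * (pathSeries a 1 + C a * pathSeries a 0) := by
  ext k
  cases k with
  | zero => simp [pathSeries, stepWords, pathWeight]
  | succ k =>
    rw [map_add, coeff_succ_X_mul, map_add, coeff_C_mul]
    simp [pathSeries, sum_stepWords_succ, pathWeight, coeff_one, Finset.mul_sum]

theorem pathSeries_succ (a : ℤ) (h : ℕ) :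
    pathSeries a (h + 1) = X * (pathSeries a (h + 2) + pathSeries a (h + 1) + pathSeries a h) := by
  ext k
  cases k with
  | zero => simp [pathSeries, stepWords, pathWeight]
  | succ k =>
    rw [coeff_succ_X_mul]
    simp [pathSeries, sum_stepWords_succ, pathWeight]

theorem motzkinSeriesAt_eq_pathSeries (a : ℤ) : motzkinSeriesAt a = pathSeries a 0 := by
  classical
  ext k
  simp only [motzkinSeriesAt, motzkinSeries, pathSeries, coeff_map, coeff_mk, map_sum, map_mul,
    map_pow, Polynomial.coe_evalRingHom, Polynomial.eval_C, Polynomial.eval_X]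
  have hw : ∀ w ∈ stepWords k, flatsAtZero w ∈ Finset.range (k + 1) := fun w hw => by
    have := Finset.card_filter_le (Finset.range w.length)
      fun i => w[i]? = some Step.flat ∧ level (w.take i) = 0
    rw [Finset.card_range] at this
    rw [Finset.mem_range, ← mem_stepWords.1 hw]
    exact Nat.lt_succ_of_le this
  rw [← Finset.sum_fiberwise_of_maps_to hw]
  refine Finset.sum_congr rfl fun j _ => ?_
  have hset : motzkinPaths k j =
      ↑((stepWords k).filter fun w => flatsAtZero w = j ∧ IsMotzkinPath w) := by
    ext w
    simp only [motzkinPaths, Finset.coe_filter, mem_stepWords, Set.mem_ofPred_eq]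
    tauto
  rw [motzkinCount, hset, Set.ncard_coe_finset, ← Finset.filter_filter, Finset.card_filter,
    Nat.cast_sum, Finset.sum_mul]
  refine Finset.sum_congr rfl fun w hw => ?_
  have h1 : IsMotzkinFrom ((0 : ℕ) : ℤ) w ↔ IsMotzkinPath w := by
    simp [IsMotzkinFrom, IsMotzkinPath]
  have h2 : flatsAtZeroFrom ((0 : ℕ) : ℤ) w = flatsAtZero w := by
    simp [flatsAtZeroFrom, flatsAtZero]
  rw [pathWeight_eq, h2, (Finset.mem_filter.1 hw).2]
  simp only [h1]
  by_cases hm : IsMotzkinPath w <;> simp [hm]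

theorem eq_zero_of_forall_X_pow_dvd {f : PowerSeries ℤ} (h : ∀ n : ℕ, X ^ n ∣ f) : f = 0 := by
  ext n
  exact X_pow_dvd_iff.1 (h (n + 1)) n n.lt_succ_self

/-- Evaluation of the Motzkin series at a series `u` in terms of the solution of
`N = u * (1 + N + N ^ 2)`. -/
theorem motzkinSeriesAt_subst {u N : PowerSeries ℤ} (a : ℤ) (hu : constantCoeff u = 0)
    (hN : N = u * (1 + N + N ^ 2)) :
    (1 - C a * u - u * N) * (motzkinSeriesAt a).subst u = 1 := by
  have hs : HasSubst u := HasSubst.of_constantCoeff_zero' hu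
  let Q : ℕ → PowerSeries ℤ := fun h => (pathSeries a h).subst u
  have Q0 : Q 0 = 1 + u * (Q 1 + C a * Q 0) := by
    have := congrArg (substAlgHom hs) (pathSeries_zero a)
    have hC : substAlgHom hs (C a : PowerSeries ℤ) = (C a : PowerSeries ℤ) := by
      rw [eq_intCast (C : ℤ →+* PowerSeries ℤ), map_intCast]
    rw [map_add, map_mul, map_add, map_mul, map_one, substAlgHom_X, hC] at this
    simpa only [Q, coe_substAlgHom] using this
  have Qs : ∀ h, Q (h + 1) = u * (Q (h + 2) + Q (h + 1) + Q h) := fun h => by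
    have := congrArg (substAlgHom hs) (pathSeries_succ a h)
    rw [map_mul, map_add, map_add, substAlgHom_X] at this
    simpa only [Q, coe_substAlgHom] using this
  have hX : X ∣ u := X_dvd_iff.2 hu
  -- The expected solution is geometric in the level, `Q (h + 1) = N * Q h`. The defects satisfy a
  -- homogeneous system with the factor `u`, which is divisible by `X`, so each pass through it
  -- gains a power of `X` for all levels at once.
  have key : ∀ n : ℕ, ∀ h, X ^ n ∣ Q (h + 1) - N * Q h := by
    intro n
    induction n with
    | zero => simp
    | succ n ih =>
      intro h
      rw [pow_succ']
      cases h with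
      | zero =>
        have e : Q 1 - N * Q 0 = u * ((Q 1 - N * Q 0) + (Q 2 - N * Q 1) + N * (Q 1 - N * Q 0)) := by
          linear_combination Qs 0 - Q 0 * hN
        rw [zero_add, e]
        exact mul_dvd_mul hX (((ih 0).add (ih 1)).add ((ih 0).mul_left _))
      | succ h =>
        have e : Q (h + 2) - N * Q (h + 1) = u * ((Q (h + 3) - N * Q (h + 2)) +
            (Q (h + 2) - N * Q (h + 1)) + (Q (h + 1) - N * Q h)) := by
          linear_combination Qs (h + 1) - N * Qs h
        rw [e]
        exact mul_dvd_mul hX (((ih (h + 2)).add (ih (h + 1))).add (ih h))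
  have h1 : Q 1 = N * Q 0 := sub_eq_zero.1 (eq_zero_of_forall_X_pow_dvd fun n => key n 0)
  rw [motzkinSeriesAt_eq_pathSeries]
  change (1 - C a * u - u * N) * Q 0 = 1
  linear_combination Q0 + u * h1

/-! ### Catalan series, ballot numbers and central binomial coefficients -/

theorem catalanGF_eq : catalanGF = 1 + X * catalanGF ^ 2 := by
  have := congrArg (PowerSeries.map (Nat.castRingHom ℤ)) catalanSeries_sq_mul_X_add_one
  rw [map_add, map_mul, map_pow, map_X, map_one] at this
  rw [catalanGF]
  linear_combination -this

theorem constantCoeff_catalanGF : constantCoeff catalanGF = 1 := by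
  rw [catalanGF_eq]; simp

theorem coeff_catalanGF (n : ℕ) : coeff n catalanGF = (catalan n : ℤ) := by
  simp [catalanGF, coeff_map]

/-- The powers of `x * c(x)` have the ballot numbers as coefficients, which are determined by
their recursion. -/
theorem coeff_X_mul_catalanGF_pow {b : ℕ → ℕ → ℕ} (h00 : b 0 0 = 1) (h0 : ∀ m, b 0 (m + 1) = 0)
    (hlt : ∀ k m, m < k → b k m = 0)
    (hrec : ∀ k m, b (k + 1) (m + 1) = b k m + b (k + 2) (m + 1)) (k m : ℕ) :
    coeff m ((X * catalanGF) ^ k) = (b k m : ℤ) := by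
  have hgt : ∀ k m, m < k → coeff m ((X * catalanGF) ^ k) = 0 := fun k m h => by
    rw [mul_pow]
    exact X_pow_dvd_iff.1 (dvd_mul_right _ _) m h
  have hq : ∀ k, (X * catalanGF) ^ (k + 1) = X * (X * catalanGF) ^ k +
      (X * catalanGF) ^ (k + 2) := fun k => by
    linear_combination (X * catalanGF) ^ k * X * catalanGF_eq
  induction m generalizing k with
  | zero =>
    cases k with
    | zero => simp [h00]
    | succ k => rw [hgt _ _ k.succ_pos, hlt _ _ k.succ_pos, Nat.cast_zero]
  | succ m ih =>
    -- The recursion expresses index `k + 1` through `k + 2` in the same degree, so the induction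
    -- descends in `k` from the range `k ≥ m + 2`, where both sides vanish.
    have hall : ∀ d k, m + 2 ≤ k + d →
        coeff (m + 1) ((X * catalanGF) ^ k) = (b k (m + 1) : ℤ) := by
      intro d
      induction d with
      | zero => intro k hk; rw [hgt _ _ (by omega), hlt _ _ (by omega), Nat.cast_zero]
      | succ d ihd =>
        intro k hk
        cases k with
        | zero => simp [h0, coeff_one]
        | succ k =>
          rw [hq k, map_add, coeff_succ_X_mul, ih k, ihd (k + 2) (by omega), hrec k, Nat.cast_add]
    exact hall (m + 2) k (by omega)

/-- The generating function of the central binomial coefficients. -/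
noncomputable def centralBinomSeries : PowerSeries ℤ :=
  PowerSeries.mk fun n => (Nat.centralBinom n : ℤ)

theorem centralBinomSeries_eq_derivative :
    centralBinomSeries = derivative ℤ (X * catalanGF) := by
  ext n
  rw [centralBinomSeries, coeff_mk, coeff_derivative, coeff_succ_X_mul, coeff_catalanGF,
    ← succ_mul_catalan_eq_centralBinom]
  push_cast
  ring

/-- Differentiating `c = 1 + x c^2` gives `c' (1 - 2 x c) = c^2`, hence `(x c)' = 1 / (1 - 2 x c)`.
Multiplying the denominator by `c` turns it into `2 - c`. -/
theorem centralBinomSeries_mul : centralBinomSeries * (2 - catalanGF) = catalanGF := by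
  have hc := catalanGF_eq
  have hd := congrArg (derivative ℤ) catalanGF_eq
  have hB := centralBinomSeries_eq_derivative
  simp only [map_add, Derivation.leibniz, Derivation.map_one_eq_zero, derivative_X,
    smul_eq_mul, pow_two] at hd hB
  set c := catalanGF
  set c' := derivative ℤ c
  have h1 : c' * (1 - 2 * X * c) = c ^ 2 := by linear_combination hd
  have h2 : centralBinomSeries * (1 - 2 * X * c) = 1 := by
    rw [hB]
    linear_combination X * h1 + hc
  linear_combination c * h2 - 2 * centralBinomSeries * hc

theorem coeff_subst_X_mul_catalanGF {b : ℕ → ℕ → ℕ}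
    (hb : ∀ k m, coeff m ((X * catalanGF) ^ k) = (b k m : ℤ)) (f : PowerSeries ℤ) (m : ℕ) :
    coeff m (f.subst (X * catalanGF)) = ∑ k ∈ Finset.range (m + 1), coeff k f * (b k m : ℤ) := by
  have hs : HasSubst (X * catalanGF) := HasSubst.of_constantCoeff_zero' (by simp)
  rw [coeff_subst' hs, finsum_eq_sum_of_support_subset (s := Finset.range (m + 1))]
  · simp [hb]
  · intro k hk
    by_contra hlt
    refine hk ?_
    have : m < k := by simpa using hlt
    have h0 : coeff m ((X * catalanGF) ^ k) = 0 := by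
      rw [mul_pow]
      exact X_pow_dvd_iff.1 (dvd_mul_right _ _) m this
    simp only [h0, smul_zero]

theorem centralBinomSeries_subst :
    centralBinomSeries.subst (X * catalanGF) =
      1 + 2 * (catalanGF - 1) * (motzkinSeriesAt 2).subst (catalanGF - 1) := by
  have hs : HasSubst (X * catalanGF) := HasSubst.of_constantCoeff_zero' (by simp)
  have hu : constantCoeff (catalanGF - 1) = 0 := by simp [constantCoeff_catalanGF]
  have h1 := congrArg (substAlgHom hs) centralBinomSeries_mul
  have h2 := congrArg (substAlgHom hs) catalanGF_eq
  rw [map_mul, map_sub, map_ofNat] at h1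
  rw [map_add, map_mul, map_pow, map_one, substAlgHom_X] at h2
  rw [← coe_substAlgHom hs]
  set G := substAlgHom hs centralBinomSeries
  set e := substAlgHom hs catalanGF with he
  -- Multiply `e = 1 + x c e^2` by `c` and replace `x c^2` by `c - 1`.
  have hN : e - 1 = (catalanGF - 1) * (1 + (e - 1) + (e - 1) ^ 2) := by
    linear_combination catalanGF * h2 - e ^ 2 * catalanGF_eq
  have h3 := motzkinSeriesAt_subst 2 hu hN
  set M := (motzkinSeriesAt 2).subst (catalanGF - 1)
  have h4 : (1 - C 2 * (catalanGF - 1) - (catalanGF - 1) * (e - 1)) ≠ 0 :=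
    left_ne_zero_of_mul_eq_one h3
  have he0 : constantCoeff e = 1 := by rw [h2]; simp
  have h5 : 2 - e ≠ 0 := fun h => by
    have := congrArg constantCoeff h
    rw [map_sub, he0, map_ofNat, map_zero] at this
    norm_num at this
  have h6 : (C 2 : PowerSeries ℤ) = 2 := map_ofNat _ 2
  rw [h6] at h3 h4
  refine mul_left_cancel₀ h4 (mul_left_cancel₀ h5 ?_)
  linear_combination (1 - 2 * (catalanGF - 1) - (catalanGF - 1) * (e - 1)) * h1 -
    (2 - e) * 2 * (catalanGF - 1) * h3 + 2 * hN

/-- The theorem follows from the formula `∑ k, b k m * (2 * k).choose k` for the numbers of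
permutations, where `b k m` are the ballot numbers. -/
theorem eq_of_ballot_sum {b : ℕ → ℕ → ℕ}
    (hb : ∀ k m, coeff m ((X * catalanGF) ^ k) = (b k m : ℤ)) {f : PowerSeries ℤ}
    (hf : ∀ m, coeff (3 * m) f = ∑ k ∈ Finset.range (m + 1), (Nat.centralBinom k : ℤ) * b k m)
    (hf0 : ∀ n, ¬ 3 ∣ n → coeff n f = 0) :
    f = 1 + 2 * (catalanCubed - 1) * (motzkinSeriesAt 2).subst (catalanCubed - 1) := by
  have hs := hasSubst_X_pow_three
  have hu : HasSubst (catalanGF - 1) :=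
    HasSubst.of_constantCoeff_zero' (by simp [constantCoeff_catalanGF])
  -- The sum in `hf` is the coefficient of `x^m` in `B(x c(x))`, because `b k m` is that of `(x
  -- c)^k`.
  have h1 : f = PowerSeries.subst (X ^ 3 : PowerSeries ℤ)
      (centralBinomSeries.subst (X * catalanGF) : PowerSeries ℤ) := by
    ext n
    rw [coeff_subst_X_pow (by norm_num)]
    split_ifs with h
    · obtain ⟨m, rfl⟩ := h
      rw [hf, Nat.mul_div_cancel_left _ (by norm_num), coeff_subst_X_mul_catalanGF hb]
      simp [centralBinomSeries]
    · exact hf0 n h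
  have h2 : (catalanGF - 1).subst (X ^ 3 : PowerSeries ℤ) = catalanCubed - 1 := by
    rw [catalanCubed, ← coe_substAlgHom hs, map_sub, map_one]
  rw [h1, centralBinomSeries_subst, ← h2, ← subst_comp_subst_apply hu hs, ← coe_substAlgHom hs]
  simp only [map_add, map_mul, map_one, map_ofNat]

end PatternCycles

namespace PatternCycles
open Finset

/-! ### Avoiders of `132` by their number of right-to-left maxima -/

theorem avoids_pattern132_iff {n : ℕ} {π : Equiv.Perm (Fin n)} :
    Avoids π pattern132 ↔ ∀ x y z, x < y → y < z → π x < π z → ¬ π z < π y := by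
  constructor
  · intro h x y z hxy hyz hxz hzy
    refine h ⟨![x, y, z], ?_, ?_⟩
    · intro a b hab
      fin_cases a <;> fin_cases b <;> simp at hab ⊢ <;> first | assumption | exact hxy.trans hyz
    · have hxy' := hxz.trans hzy
      intro a b
      fin_cases a <;> fin_cases b <;>
        simp [pattern132, Equiv.swap_apply_def, hxz, hzy, hxy', hxz.le, hzy.le, hxy'.le]
  · rintro h ⟨f, hf, hπ⟩
    refine h (f 0) (f 1) (f 2) (hf (by decide)) (hf (by decide)) ?_ ?_
    · rw [hπ]; decide
    · rw [hπ]; decide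

/-- The positions of the right-to-left maxima of `τ`. -/
def rightToLeftMaxima {m : ℕ} (τ : Equiv.Perm (Fin m)) : Finset (Fin m) :=
  univ.filter fun i => ∀ j, i < j → τ j < τ i

theorem mem_rightToLeftMaxima {m : ℕ} {τ : Equiv.Perm (Fin m)} {i : Fin m} :
    i ∈ rightToLeftMaxima τ ↔ ∀ j, i < j → τ j < τ i := by
  simp [rightToLeftMaxima]

/-- The permutation obtained from `τ` by inserting a new maximum at position `p`. -/
def insertMax {m : ℕ} (p : Fin (m + 1)) (τ : Equiv.Perm (Fin m)) : Equiv.Perm (Fin (m + 1)) :=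
  (finSuccEquiv' p).trans ((Equiv.optionCongr τ).trans (finSuccEquiv' (Fin.last m)).symm)

@[simp]
theorem insertMax_self {m : ℕ} (p : Fin (m + 1)) (τ : Equiv.Perm (Fin m)) :
    insertMax p τ p = Fin.last m := by
  simp [insertMax]

@[simp]
theorem insertMax_succAbove {m : ℕ} (p : Fin (m + 1)) (τ : Equiv.Perm (Fin m)) (i : Fin m) :
    insertMax p τ (p.succAbove i) = (τ i).castSucc := by
  simp [insertMax]

theorem insertMax_bijective (m : ℕ) :
    Function.Bijective fun x : Fin (m + 1) × Equiv.Perm (Fin m) => insertMax x.1 x.2 := by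
  rw [Fintype.bijective_iff_injective_and_card]
  constructor
  · rintro ⟨p, τ⟩ ⟨q, τ'⟩ h
    dsimp only at h
    have hpq : p = q := (insertMax q τ').injective <| by
      rw [insertMax_self, ← h, insertMax_self]
    subst hpq
    refine Prod.ext rfl (Equiv.ext fun i => Fin.castSucc_injective m ?_)
    dsimp only
    rw [← insertMax_succAbove p, h, insertMax_succAbove]
  · simp [Fintype.card_perm, Nat.factorial_succ]

/-- The new maximum can only play the role of the `3`, since the other two entries of the pattern
need a larger one. -/
theorem avoids_insertMax_iff {m : ℕ} {p : Fin (m + 1)} {τ : Equiv.Perm (Fin m)} :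
    Avoids (insertMax p τ) pattern132 ↔ Avoids τ pattern132 ∧
      ∀ i j, p.succAbove i < p → p < p.succAbove j → τ j < τ i := by
  simp only [avoids_pattern132_iff]
  constructor
  · intro h
    constructor
    · intro x y z hxy hyz hxz hzy
      refine h (p.succAbove x) (p.succAbove y) (p.succAbove z) ?_ ?_ ?_ ?_ <;> simpa
    · intro i j hi hj
      by_contra hij
      have hne : i ≠ j := by rintro rfl; exact lt_asymm hi hj
      refine h (p.succAbove i) p (p.succAbove j) hi hj ?_ ?_
      · simpa using lt_of_le_of_ne (not_lt.1 hij) (fun e => hne (τ.injective e))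
      · simp [Fin.castSucc_lt_last]
  · rintro ⟨h1, h2⟩ x y z hxy hyz hxz hzy
    rcases Fin.eq_self_or_eq_succAbove p x with rfl | ⟨x, rfl⟩
    · rw [insertMax_self] at hxz; exact absurd hxz (Fin.le_last _).not_gt
    rcases Fin.eq_self_or_eq_succAbove p z with rfl | ⟨z, rfl⟩
    · rw [insertMax_self] at hzy; exact absurd hzy (Fin.le_last _).not_gt
    rw [insertMax_succAbove, insertMax_succAbove, Fin.castSucc_lt_castSucc_iff] at hxz
    rcases Fin.eq_self_or_eq_succAbove p y with rfl | ⟨y, rfl⟩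
    · exact lt_asymm hxz (h2 x z hxy hyz)
    · rw [insertMax_succAbove, insertMax_succAbove, Fin.castSucc_lt_castSucc_iff] at hzy
      exact h1 x y z (by simpa using hxy) (by simpa using hyz) hxz hzy

/-- In a permutation that avoids `132`, the entries before a gap exceed those after it exactly if
the gap is the initial one or follows a right-to-left maximum. -/
theorem forall_lt_of_gap_iff {m : ℕ} {p : Fin (m + 1)} {τ : Equiv.Perm (Fin m)}
    (hτ : Avoids τ pattern132) :
    (∀ i j, p.succAbove i < p → p < p.succAbove j → τ j < τ i) ↔
      p ∈ insert 0 ((rightToLeftMaxima τ).image Fin.succ) := by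
  rw [avoids_pattern132_iff] at hτ
  simp only [Fin.succAbove_lt_iff_castSucc_lt, Fin.lt_succAbove_iff_le_castSucc, mem_insert,
    mem_image]
  constructor
  · intro h
    rcases Fin.eq_zero_or_eq_succ p with rfl | ⟨v, rfl⟩
    · exact Or.inl rfl
    · refine Or.inr ⟨v, mem_rightToLeftMaxima.2 fun j hj => h v j ?_ ?_, rfl⟩
      · exact Fin.castSucc_lt_succ
      · rwa [Fin.le_castSucc_iff, Fin.succ_lt_succ_iff]
  · rintro (rfl | ⟨v, hv, rfl⟩) i j hi hj
    · exact absurd hi (Fin.zero_le _).not_gt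
    · rw [Fin.le_castSucc_iff, Fin.succ_lt_succ_iff] at hj
      rw [Fin.castSucc_lt_succ_iff] at hi
      have hvj := mem_rightToLeftMaxima.1 hv j hj
      rcases hi.eq_or_lt with rfl | hi
      · exact hvj
      · by_contra hij
        have hne : i ≠ j := (hi.trans hj).ne
        exact hτ i v j hi hj (lt_of_le_of_ne (not_lt.1 hij) fun e => hne (τ.injective e)) hvj

/-- The new maximum is a right-to-left maximum, destroys those on its left and leaves those on its
right. -/
theorem rightToLeftMaxima_insertMax {m : ℕ} (p : Fin (m + 1)) (τ : Equiv.Perm (Fin m)) :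
    rightToLeftMaxima (insertMax p τ) = insert p
      (((rightToLeftMaxima τ).filter fun i => p ≤ i.castSucc).map p.succAboveEmb) := by
  ext x
  rw [mem_rightToLeftMaxima, mem_insert, mem_map]
  rcases Fin.eq_self_or_eq_succAbove p x with rfl | ⟨i, rfl⟩
  · simp only [insertMax_self, true_or, iff_true]
    intro j hj
    obtain ⟨j, rfl⟩ := Fin.exists_succAbove_eq hj.ne'
    simp [Fin.castSucc_lt_last]
  · simp only [Fin.succAbove_ne, false_or, Fin.succAboveEmb_apply, Fin.succAbove_right_inj,
      exists_eq_right, mem_filter, mem_rightToLeftMaxima]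
    constructor
    · intro h
      constructor
      · intro j hj
        simpa using h (p.succAbove j) (by simpa using hj)
      · by_contra hp
        rw [not_le, ← Fin.succAbove_lt_iff_castSucc_lt] at hp
        have := h p hp
        rw [insertMax_self] at this
        exact absurd this (Fin.le_last _).not_gt
    · rintro ⟨h1, h2⟩ j hj
      rw [← Fin.lt_succAbove_iff_le_castSucc] at h2
      obtain ⟨j, rfl⟩ := Fin.exists_succAbove_eq (h2.trans hj).ne'
      simpa using h1 j (by simpa using hj)

theorem card_rightToLeftMaxima_insertMax {m : ℕ} (p : Fin (m + 1)) (τ : Equiv.Perm (Fin m)) :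
    (rightToLeftMaxima (insertMax p τ)).card =
      ((rightToLeftMaxima τ).filter fun i => p ≤ i.castSucc).card + 1 := by
  rw [rightToLeftMaxima_insertMax, card_insert_of_notMem, card_map]
  simp [Fin.succAbove_ne]

/-- Among the initial gap and the gaps that follow the elements of `V`, exactly one has `k`
elements of `V` on its right, for each `k ≤ #V`. -/
theorem card_gaps_with_card_right {m : ℕ} (V : Finset (Fin m)) (k : ℕ) :
    ((insert 0 (V.image Fin.succ)).filter fun p : Fin (m + 1) =>
      (V.filter fun i => p ≤ i.castSucc).card = k).card = if k ≤ V.card then 1 else 0 := by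
  have hcard : (insert 0 (V.image Fin.succ)).card = V.card + 1 := by
    rw [card_insert_of_notMem (by simp [Fin.succ_ne_zero]),
      card_image_of_injective _ (Fin.succ_injective m)]
  have hinj : Set.InjOn (fun p : Fin (m + 1) => (V.filter fun i => p ≤ i.castSucc).card)
      (insert 0 (V.image Fin.succ) : Finset (Fin (m + 1))) := by
    -- A gap `q = v.succ` has `v` on its left, whereas every earlier gap has `v` on its right.
    have hlt : ∀ p q : Fin (m + 1), q ∈ insert 0 (V.image Fin.succ) → p < q →
        (V.filter fun i => q ≤ i.castSucc).card < (V.filter fun i => p ≤ i.castSucc).card := by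
      intro p q hq hpq
      have hq0 : q ≠ 0 := (p.zero_le.trans_lt hpq).ne'
      obtain ⟨v, hv, rfl⟩ : ∃ v ∈ V, Fin.succ v = q := by simpa [hq0] using hq
      refine card_lt_card (Finset.ssubset_iff_subset_ne.2 ⟨?_, fun h => ?_⟩)
      · exact monotone_filter_right _ fun i _ hi => hpq.le.trans hi
      · have : v ∈ V.filter fun i => v.succ ≤ i.castSucc := by
          rw [h, mem_filter]
          exact ⟨hv, Fin.le_castSucc_iff.2 hpq⟩
        exact absurd (mem_filter.1 this).2 Fin.castSucc_lt_succ.not_ge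
    intro p hp q hq h
    by_contra hne
    rcases lt_or_gt_of_ne hne with hpq | hpq
    · exact absurd h (hlt p q hq hpq).ne'
    · exact absurd h (hlt q p hp hpq).ne
  have himage : (insert 0 (V.image Fin.succ)).image
      (fun p : Fin (m + 1) => (V.filter fun i => p ≤ i.castSucc).card) = range (V.card + 1) := by
    refine eq_of_subset_of_card_le ?_ ?_
    · intro x hx
      obtain ⟨p, -, rfl⟩ := mem_image.1 hx
      exact mem_range.2 (Nat.lt_succ_of_le (card_filter_le _ _))
    · rw [card_image_of_injOn hinj, hcard, card_range]
  split_ifs with hk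
  · have : k ∈ (insert 0 (V.image Fin.succ)).image
        (fun p : Fin (m + 1) => (V.filter fun i => p ≤ i.castSucc).card) := by
      rw [himage, mem_range]; omega
    obtain ⟨p, hp, hpk⟩ := mem_image.1 this
    refine card_eq_one.2 ⟨p, ?_⟩
    ext q
    rw [mem_filter, mem_singleton]
    constructor
    · rintro ⟨hq, hqk⟩
      exact hinj hq hp (hqk.trans hpk.symm)
    · rintro rfl
      exact ⟨hp, hpk⟩
  · refine card_eq_zero.2 (filter_eq_empty_iff.2 fun p _ h => hk ?_)
    rw [← h]
    exact card_filter_le _ _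

open Classical in
/-- The number of permutations of `[m]` that avoid `132` and have `k` right-to-left maxima. -/
noncomputable def rlmCount (k m : ℕ) : ℕ :=
  (univ.filter fun τ : Equiv.Perm (Fin m) =>
    Avoids τ pattern132 ∧ (rightToLeftMaxima τ).card = k).card

-- An avoider `τ` admits the new maximum exactly at the gaps of `forall_lt_of_gap_iff`. By
-- `card_gaps_with_card_right`, one of these keeps exactly `k` old right-to-left maxima if `τ` has
-- at least `k`, and none does otherwise.
open Classical in
theorem rlmCount_succ_succ_eq_card (k m : ℕ) :
    rlmCount (k + 1) (m + 1) = (univ.filter fun τ : Equiv.Perm (Fin m) =>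
      Avoids τ pattern132 ∧ k ≤ (rightToLeftMaxima τ).card).card := by
  rw [rlmCount, card_filter, ← Fintype.sum_bijective _ (insertMax_bijective m) _ _ fun _ => rfl,
    Fintype.sum_prod_type_right, card_filter]
  refine sum_congr rfl fun τ _ => ?_
  by_cases hτ : Avoids τ pattern132
  · simp only [hτ, true_and, ← card_gaps_with_card_right, avoids_insertMax_iff,
      forall_lt_of_gap_iff hτ, card_rightToLeftMaxima_insertMax, Nat.add_right_cancel_iff]
    rw [← card_filter, ← filter_filter]
    congr 2
    ext p
    simp
  · simp [hτ, avoids_insertMax_iff]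

/-- Split "at least `k`" into "exactly `k`" and "at least `k + 1`". -/
theorem rlmCount_succ_succ (k m : ℕ) :
    rlmCount (k + 1) (m + 1) = rlmCount k m + rlmCount (k + 2) (m + 1) := by
  classical
  rw [rlmCount_succ_succ_eq_card, rlmCount_succ_succ_eq_card, rlmCount, ← card_union_of_disjoint]
  · congr 1
    ext τ
    simp only [mem_filter, mem_univ, true_and, mem_union, ← and_or_left]
    refine and_congr_right fun _ => ?_
    omega
  · rw [disjoint_filter]
    intro τ _ h1 h2
    omega

theorem rlmCount_zero_zero : rlmCount 0 0 = 1 := by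
  classical
  rw [rlmCount, filter_true_of_mem, card_univ]
  · simp
  · intro τ _
    refine ⟨avoids_pattern132_iff.2 fun x => x.elim0, ?_⟩
    rw [card_eq_zero]
    exact eq_empty_of_forall_notMem fun x => x.elim0

theorem rlmCount_zero_succ (m : ℕ) : rlmCount 0 (m + 1) = 0 := by
  classical
  rw [rlmCount, card_eq_zero, filter_eq_empty_iff]
  rintro τ - ⟨-, h⟩
  rw [card_eq_zero] at h
  have : Fin.last m ∈ rightToLeftMaxima τ :=
    mem_rightToLeftMaxima.2 fun j hj => absurd hj (Fin.le_last j).not_gt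
  simp [h] at this

theorem rlmCount_eq_zero_of_lt {k m : ℕ} (h : m < k) : rlmCount k m = 0 := by
  classical
  rw [rlmCount, card_eq_zero, filter_eq_empty_iff]
  rintro τ - ⟨-, hk⟩
  have := card_le_univ (rightToLeftMaxima τ)
  rw [Fintype.card_fin] at this
  omega

open PowerSeries in
theorem coeff_X_mul_catalanGF_pow_eq_rlmCount (k m : ℕ) :
    coeff m ((X * catalanGF) ^ k) = (rlmCount k m : ℤ) :=
  coeff_X_mul_catalanGF_pow rlmCount_zero_zero rlmCount_zero_succ
    (fun _ _ => rlmCount_eq_zero_of_lt) rlmCount_succ_succ k m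

/-! ### Counting monotone maps and block maps -/

theorem mem_iff_lt_card_of_isLowerSet {n : ℕ} {M : Finset (Fin n)}
    (hM : IsLowerSet (M : Set (Fin n))) (i : Fin n) : i ∈ M ↔ (i : ℕ) < M.card := by
  constructor
  · intro hi
    have : Iic i ⊆ M := fun j hj => hM (mem_Iic.1 hj) hi
    have := card_le_card this
    rw [Fin.card_Iic] at this
    omega
  · intro hi
    by_contra h
    have : M ⊆ Iio i := fun j hj => mem_Iio.2 <| by
      by_contra hij
      exact h (hM (not_lt.1 hij) hj)
    have := card_le_card this
    rw [Fin.card_Iio] at this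
    omega

theorem add_sub_le_of_orderEmbedding {a n : ℕ} (s : Fin a ↪o Fin n) {i j : Fin a} (h : i ≤ j) :
    (s i : ℕ) + (j - i) ≤ s j := by
  have key : ∀ d, ∀ hd : (i : ℕ) + d < a, (s i : ℕ) + d ≤ s ⟨i + d, hd⟩ := by
    intro d
    induction d with
    | zero => intro hd; rfl
    | succ d ih =>
      intro hd
      have h1 := ih (by omega)
      have h2 : s ⟨i + d, by omega⟩ < s ⟨i + (d + 1), hd⟩ := s.strictMono (by simp)
      have : (s ⟨i + d, by omega⟩ : ℕ) < s ⟨i + (d + 1), hd⟩ := h2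
      omega
  have h' : (i : ℕ) ≤ j := h
  have := key (j - i) (by omega)
  simpa [Nat.add_sub_cancel' h'] using this

theorem val_le_of_orderEmbedding {a n : ℕ} (s : Fin a ↪o Fin n) (i : Fin a) : (i : ℕ) ≤ s i := by
  have := add_sub_le_of_orderEmbedding s (i := ⟨0, i.pos⟩) (j := i) (Nat.zero_le _)
  dsimp only at this
  omega

theorem val_le_add_of_orderEmbedding {a b : ℕ} (s : Fin a ↪o Fin (a + b)) (i : Fin a) :
    (s i : ℕ) ≤ i + b := by
  have := add_sub_le_of_orderEmbedding s (i := i) (j := ⟨a - 1, by have := i.pos; omega⟩)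
    (Nat.le_sub_one_of_lt i.2)
  have h2 := (s ⟨a - 1, by have := i.pos; omega⟩).2
  dsimp only at this
  omega

/-- Subtracting the index turns strictly increasing sequences into weakly increasing ones. -/
def orderEmbeddingEquivOrderHom (a b : ℕ) :
    (Fin a ↪o Fin (a + b)) ≃ (Fin a →o Fin (b + 1)) where
  toFun s := ⟨fun i => ⟨s i - i, by have := val_le_add_of_orderEmbedding s i; omega⟩, fun i j h => by
    have h1 := add_sub_le_of_orderEmbedding s h
    have h2 : (i : ℕ) ≤ j := h
    rw [Fin.mk_le_mk]
    omega⟩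
  invFun g := OrderEmbedding.ofStrictMono (fun i => ⟨g i + i, by have := (g i).2; omega⟩)
    fun i j h => by
      have h1 : (g i : ℕ) ≤ g j := g.monotone h.le
      have h2 : (i : ℕ) < j := h
      rw [Fin.mk_lt_mk]
      omega
  left_inv s := by
    ext i
    have := val_le_of_orderEmbedding s i
    change (s i - i : ℕ) + i = s i
    omega
  right_inv g := by
    ext i
    change (g i + i : ℕ) - i = g i
    omega

theorem orderEmbeddingEquivOrderHom_apply_val {a b : ℕ} (s : Fin a ↪o Fin (a + b)) (i : Fin a) :
    (orderEmbeddingEquivOrderHom a b s i : ℕ) = s i - i := rfl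

theorem card_fin_orderHom_fin (a b : ℕ) :
    Nat.card (Fin a →o Fin (b + 1)) = (a + b).choose a := by
  rw [← Nat.card_congr (orderEmbeddingEquivOrderHom a b),
    Nat.card_congr Set.powersetCard.ofFinEmbEquiv, Set.powersetCard.card, Nat.card_fin]

theorem card_orderHom {α β : Type*} [LinearOrder α] [LinearOrder β] [Fintype α] [Fintype β]
    {a b : ℕ} (ha : Fintype.card α = a) (hb : Fintype.card β = b + 1) :
    Nat.card (α →o β) = (a + b).choose a := by
  rw [← card_fin_orderHom_fin]
  exact Nat.card_congr ((Fintype.orderIsoFinOfCardEq α ha).symm.arrowCongr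
    (Fintype.orderIsoFinOfCardEq β hb).symm).toEquiv

/-- The monotone maps that are constant on the intervals which end at the elements of `V`, and
whose values are ends of such intervals. -/
def blockMaps {m : ℕ} (V : Finset (Fin m)) : Set (Fin m →o Fin (m + 1)) :=
  {g | (∀ i j, i ≤ j → (∀ v ∈ V, i ≤ v → j ≤ v) → g i = g j) ∧
    ∀ l, g l ∈ insert 0 (V.image Fin.succ)}

section blockMaps

variable {m : ℕ} {V : Finset (Fin m)}

theorem nonempty_filter_le (hV : ∀ i, ∃ v ∈ V, i ≤ v) (i : Fin m) : (V.filter (i ≤ ·)).Nonempty :=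
  let ⟨v, hv, hi⟩ := hV i
  ⟨v, mem_filter.2 ⟨hv, hi⟩⟩

/-- The end of the interval that contains `i`. -/
def blockEnd (hV : ∀ i, ∃ v ∈ V, i ≤ v) (i : Fin m) : Fin m := (V.filter (i ≤ ·)).min' (nonempty_filter_le hV i)

theorem blockEnd_mem (hV : ∀ i, ∃ v ∈ V, i ≤ v) (i : Fin m) : blockEnd hV i ∈ V :=
  (mem_filter.1 (min'_mem _ (nonempty_filter_le hV i))).1

theorem le_blockEnd (hV : ∀ i, ∃ v ∈ V, i ≤ v) (i : Fin m) : i ≤ blockEnd hV i :=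
  (mem_filter.1 (min'_mem _ (nonempty_filter_le hV i))).2

theorem blockEnd_le (hV : ∀ i, ∃ v ∈ V, i ≤ v) {i v : Fin m} (hv : v ∈ V) (h : i ≤ v) : blockEnd hV i ≤ v :=
  min'_le _ _ (mem_filter.2 ⟨hv, h⟩)

/-- The block maps are determined by their values at the ends of the blocks. -/
def blockMapsEquiv (hV : ∀ i, ∃ v ∈ V, i ≤ v) :
    blockMaps V ≃ (V →o (insert 0 (V.image Fin.succ) : Finset (Fin (m + 1)))) where
  toFun g := ⟨fun v => ⟨g.1 v, g.2.2 v⟩, fun _ _ h => g.1.monotone h⟩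
  invFun h := ⟨⟨fun i => h ⟨blockEnd hV i, blockEnd_mem hV i⟩, fun i j hij => h.monotone <|
      blockEnd_le hV (blockEnd_mem hV j) (hij.trans (le_blockEnd hV j))⟩, fun i j hij hv => by
    have : blockEnd hV i = blockEnd hV j := le_antisymm
      (blockEnd_le hV (blockEnd_mem hV j) (hij.trans (le_blockEnd hV j)))
      (blockEnd_le hV (blockEnd_mem hV i) (hv _ (blockEnd_mem hV i) (le_blockEnd hV i)))
    change (h _ : Fin (m + 1)) = h _
    simp only [this], fun l => (h _).2⟩
  left_inv g := by
    refine Subtype.ext (OrderHom.ext _ _ (funext fun i => ?_))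
    exact (g.2.1 i (blockEnd hV i) (le_blockEnd hV i) fun v hv h => blockEnd_le hV hv h).symm
  right_inv h := by
    refine OrderHom.ext _ _ (funext fun v => Subtype.ext ?_)
    have : blockEnd hV v.1 = v.1 := le_antisymm (blockEnd_le hV v.2 le_rfl) (le_blockEnd hV _)
    change (h _ : Fin (m + 1)) = h _
    simp only [this]

/-- These are monotone maps from a chain of `k = #V` blocks to a chain of `k + 1` boundaries, the
extra boundary being `0`. -/
theorem card_blockMaps (hV : ∀ i, ∃ v ∈ V, i ≤ v) : Nat.card (blockMaps V) = Nat.centralBinom V.card := by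
  rw [Nat.card_congr (blockMapsEquiv hV), card_orderHom (a := V.card) (b := V.card),
    Nat.centralBinom_eq_two_mul_choose, two_mul]
  · simp
  · rw [Fintype.card_coe, card_insert_of_notMem (by simp [Fin.succ_ne_zero]),
      card_image_of_injective _ (Fin.succ_injective m)]

end blockMaps

/-! ### Layouts of `3`-cycles and their avoidance of `132` -/

theorem cycleLengthsIn_three_iff {n : ℕ} {π : Equiv.Perm (Fin n)} :
    CycleLengthsIn {3} π ↔ ∀ x, π (π (π x)) = x ∧ π x ≠ x := by
  refine forall_congr' fun x => ?_
  rw [Set.mem_singleton_iff]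
  constructor
  · intro h
    have h3 := Function.isPeriodicPt_minimalPeriod π x
    rw [h] at h3
    refine ⟨h3, fun h1 => ?_⟩
    rw [Function.minimalPeriod_eq_one_iff_isFixedPt.2 h1] at h
    omega
  · rintro ⟨h3, h1⟩
    have : Fact (Nat.Prime 3) := ⟨Nat.prime_three⟩
    exact Function.minimalPeriod_eq_prime h3 h1

theorem avoids_pattern132_symm {n : ℕ} {π : Equiv.Perm (Fin n)} (h : Avoids π pattern132) :
    Avoids π.symm pattern132 := by
  rw [avoids_pattern132_iff] at h ⊢
  intro x y z hxy hyz hxz hzy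
  exact h (π.symm x) (π.symm z) (π.symm y) hxz hzy (by simpa) (by simpa)

/-- The cycles of `π` are `(a (τ i), s i, t i)`, where the sequences `a`, `s`, `t` are increasing
and all elements of `a` precede those of `s` and `t`. -/
structure ThreeCycleLayout {m n : ℕ} (π : Equiv.Perm (Fin n)) (τ : Equiv.Perm (Fin m))
    (a s t : Fin m → Fin n) : Prop where
  a_strictMono : StrictMono a
  s_strictMono : StrictMono s
  t_strictMono : StrictMono t
  a_lt_s : ∀ i j, a i < s j
  a_lt_t : ∀ i j, a i < t j
  cover : ∀ x, (∃ i, x = a (τ i)) ∨ (∃ i, x = s i) ∨ ∃ i, x = t i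
  map_a : ∀ i, π (a (τ i)) = s i
  map_s : ∀ i, π (s i) = t i
  map_t : ∀ i, π (t i) = a (τ i)

namespace ThreeCycleLayout

variable {m n : ℕ} {π : Equiv.Perm (Fin n)} {τ : Equiv.Perm (Fin m)} {a s t : Fin m → Fin n}

theorem cycleLengthsIn (h : ThreeCycleLayout π τ a s t) : CycleLengthsIn {3} π := by
  rw [cycleLengthsIn_three_iff]
  intro x
  rcases h.cover x with ⟨i, rfl⟩ | ⟨i, rfl⟩ | ⟨i, rfl⟩
  · simp only [h.map_a, h.map_s, h.map_t, true_and]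
    exact (h.a_lt_s _ _).ne'
  · simp only [h.map_a, h.map_s, h.map_t, true_and]
    intro e
    have := h.map_t i
    rw [e, h.map_s] at this
    exact (h.a_lt_t _ _).ne' this
  · simp only [h.map_a, h.map_s, h.map_t, true_and]
    exact (h.a_lt_t _ _).ne

/-- On `a` the values of `π` are ordered as in the inverse of `τ`, on `s` they increase, on `t` they
are ordered as in `τ`. As `132` is its own inverse, patterns inside one class only concern `τ`.
Among mixed patterns, only positions of types `a, a, s` and `t, s, t` are possible; they give the
two interleaving conditions. -/
theorem avoids_iff (h : ThreeCycleLayout π τ a s t) :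
    Avoids π pattern132 ↔ Avoids τ pattern132 ∧ ∀ i j, i < j → τ i < τ j → ∀ l,
      ¬ (s i < t l ∧ t l < s j) ∧ ¬ (t i < s l ∧ s l < t j) := by
  have ha {i j} : a i < a j ↔ i < j := h.a_strictMono.lt_iff_lt
  have hs {i j} : s i < s j ↔ i < j := h.s_strictMono.lt_iff_lt
  have ht {i j} : t i < t j ↔ i < j := h.t_strictMono.lt_iff_lt
  have hsa {i j} : ¬ s i < a j := (h.a_lt_s j i).not_gt
  have hta {i j} : ¬ t i < a j := (h.a_lt_t j i).not_gt
  constructor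
  · intro hπ
    rw [avoids_pattern132_iff] at hπ
    refine ⟨?_, fun i j hij hτ l => ⟨?_, ?_⟩⟩
    · rw [avoids_pattern132_iff]
      intro x y z hxy hyz hxz hzy
      refine hπ (t x) (t y) (t z) (ht.2 hxy) (ht.2 hyz) ?_ ?_ <;> simpa [h.map_t, ha]
    · rintro ⟨h1, h2⟩
      refine hπ (a (τ i)) (a (τ j)) (s l) (ha.2 hτ) (h.a_lt_s _ _) ?_ ?_ <;>
        simpa [h.map_a, h.map_s]
    · rintro ⟨h1, h2⟩
      refine hπ (t i) (s l) (t j) h1 h2 ?_ ?_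
      · simpa [h.map_t, ha]
      · simpa [h.map_t, h.map_s] using h.a_lt_t _ _
  · rintro ⟨hτ, hst⟩
    have hτ' := avoids_pattern132_iff.1 (avoids_pattern132_symm hτ)
    rw [avoids_pattern132_iff] at hτ ⊢
    intro x y z hxy hyz hxz hzy
    rcases h.cover x with ⟨i, rfl⟩ | ⟨i, rfl⟩ | ⟨i, rfl⟩ <;>
    rcases h.cover y with ⟨j, rfl⟩ | ⟨j, rfl⟩ | ⟨j, rfl⟩ <;>
    rcases h.cover z with ⟨l, rfl⟩ | ⟨l, rfl⟩ | ⟨l, rfl⟩ <;>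
    simp only [h.map_a, h.map_s, h.map_t, ha, hs, ht, hsa, hta] at hxy hyz hxz hzy
    · exact hτ' (τ i) (τ j) (τ l) hxy hyz (by simpa) (by simpa)
    · exact (hst i j (hxz.trans hzy |> hs.1) hxy l).1 ⟨hxz, hzy⟩
    all_goals first
      | exact lt_asymm hyz hzy
      | exact hτ i j l hxy hyz hxz hzy
      | exact (hst i l (ht.1 (hxy.trans hyz)) hxz j).2 ⟨hxy, hyz⟩

end ThreeCycleLayout

section layoutPerm

variable {m : ℕ} (τ : Equiv.Perm (Fin m)) (s : Fin m ↪o Fin (m + m))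

theorem card_compl_map : (univ.map s.toEmbedding)ᶜ.card = m := by
  rw [card_compl, card_map, card_univ, Fintype.card_fin, Fintype.card_fin, Nat.add_sub_cancel]

/-- The increasing enumeration of the elements outside the range of `s`. -/
def complEmb : Fin m ↪o Fin (m + m) := (univ.map s.toEmbedding)ᶜ.orderEmbOfFin (card_compl_map s)

theorem range_complEmb : Set.range (complEmb s) = (Set.range s)ᶜ := by
  rw [complEmb, range_orderEmbOfFin]
  ext x
  simp

theorem complEmb_ne (i j : Fin m) : s i ≠ complEmb s j := fun h => by
  have : complEmb s j ∈ (Set.range s)ᶜ := by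
    rw [← range_complEmb]
    exact Set.mem_range_self j
  exact this ⟨i, h⟩

theorem exists_eq_or_complEmb (x : Fin (m + m)) : (∃ i, x = s i) ∨ ∃ i, x = complEmb s i := by
  by_cases h : x ∈ Set.range s
  · exact Or.inl (h.imp fun _ => Eq.symm)
  · have : x ∈ Set.range (complEmb s) := by rwa [range_complEmb]
    exact Or.inr (this.imp fun _ => Eq.symm)

/-- Of the `s j` points below `s j`, exactly `j` belong to `s`; the other `s j - j` are the first
ones of the complement. -/
theorem complEmb_lt_iff (l j : Fin m) : complEmb s l < s j ↔ (l : ℕ) + j < s j := by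
  let M : Finset (Fin m) := univ.filter fun l => complEmb s l < s j
  have hM : IsLowerSet (M : Set (Fin m)) := fun x y hyx hx => by
    have : complEmb s x < s j := by simpa [M] using hx
    simpa [M] using ((complEmb s).monotone hyx).trans_lt this
  have hcard : (s j : ℕ) = j + M.card := by
    have hIio : Iio (s j) = (Iio j).map s.toEmbedding ∪ M.map (complEmb s).toEmbedding := by
      ext x
      rcases exists_eq_or_complEmb s x with ⟨i, rfl⟩ | ⟨i, rfl⟩
      · simp [M, (complEmb_ne s _ _).symm]
      · simp [M, complEmb_ne s]
    have hdisj : Disjoint ((Iio j).map s.toEmbedding) (M.map (complEmb s).toEmbedding) := by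
      rw [disjoint_left]
      intro x hx hx'
      obtain ⟨i, -, rfl⟩ := mem_map.1 hx
      obtain ⟨i', -, h⟩ := mem_map.1 hx'
      exact complEmb_ne s i i' h.symm
    have := congrArg card hIio
    rwa [card_union_of_disjoint hdisj, card_map, card_map, Fin.card_Iio, Fin.card_Iio] at this
  have := mem_iff_lt_card_of_isLowerSet hM l
  simp only [M, mem_filter, mem_univ, true_and] at this
  rw [this]
  change l.val < M.card ↔ _
  omega

/-- The cyclic rotation of three copies of a type. -/
def rotateCopies (α : Type*) : Equiv.Perm (α ⊕ (α ⊕ α)) where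
  toFun
    | .inl i => .inr (.inl i)
    | .inr (.inl i) => .inr (.inr i)
    | .inr (.inr i) => .inl i
  invFun
    | .inl i => .inr (.inr i)
    | .inr (.inl i) => .inl i
    | .inr (.inr i) => .inr (.inl i)
  left_inv := by rintro (i | i | i) <;> rfl
  right_inv := by rintro (i | i | i) <;> rfl

/-- The positions of the elements of the `3`-cycles, with the cycles as index set. -/
noncomputable def layoutEquiv : Fin m ⊕ (Fin m ⊕ Fin m) ≃ Fin (m + (m + m)) :=
  (Equiv.sumCongr τ (Equiv.ofBijective (Sum.elim s (complEmb s)) (by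
    rw [Fintype.bijective_iff_injective_and_card]
    exact ⟨s.injective.sumElim (complEmb s).injective (complEmb_ne s), by simp⟩))).trans
      finSumFinEquiv

/-- The permutation with the `3`-cycles `(a (τ i), s i, t i)`, where `a` and `t` are the increasing
enumerations of the elements of the first third, and of the elements outside the first third and
the range of `s`. -/
noncomputable def layoutPerm : Equiv.Perm (Fin (m + (m + m))) :=
  (layoutEquiv τ s).permCongr (rotateCopies (Fin m))

theorem layoutPerm_layoutEquiv (x : Fin m ⊕ (Fin m ⊕ Fin m)) :
    layoutPerm τ s (layoutEquiv τ s x) = layoutEquiv τ s (rotateCopies (Fin m) x) := by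
  simp [layoutPerm, Equiv.permCongr_apply]

theorem threeCycleLayout_layoutPerm : ThreeCycleLayout (layoutPerm τ s) τ (Fin.castAdd (m + m))
    (fun i => Fin.natAdd m (s i)) (fun i => Fin.natAdd m (complEmb s i)) where
  a_strictMono := Fin.strictMono_castAdd _
  s_strictMono := (Fin.strictMono_natAdd m).comp s.strictMono
  t_strictMono := (Fin.strictMono_natAdd m).comp (complEmb s).strictMono
  a_lt_s i _ := Fin.lt_def.2 (Nat.lt_add_right _ i.2)
  a_lt_t i _ := Fin.lt_def.2 (Nat.lt_add_right _ i.2)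
  cover x := by
    obtain ⟨i | i | i, rfl⟩ := (layoutEquiv τ s).surjective x
    · exact Or.inl ⟨i, rfl⟩
    · exact Or.inr (Or.inl ⟨i, rfl⟩)
    · exact Or.inr (Or.inr ⟨i, rfl⟩)
  map_a i := layoutPerm_layoutEquiv τ s (.inl i)
  map_s i := layoutPerm_layoutEquiv τ s (.inr (.inl i))
  map_t i := layoutPerm_layoutEquiv τ s (.inr (.inr i))

/-- The range of `s` is recovered as the image of the first third, after which the values on `t`
give `τ`. -/
theorem layoutPerm_injective : Function.Injective
    fun x : Equiv.Perm (Fin m) × (Fin m ↪o Fin (m + m)) => layoutPerm x.1 x.2 := by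
  rintro ⟨τ, s⟩ ⟨τ', s'⟩ h
  dsimp only at h
  have hr : ∀ (τ : Equiv.Perm (Fin m)) (s : Fin m ↪o Fin (m + m)), Set.range s =
      {x | ∃ i, layoutPerm τ s (Fin.castAdd (m + m) i) = Fin.natAdd m x} := by
    intro τ s
    ext x
    constructor
    · rintro ⟨i, rfl⟩
      exact ⟨τ i, (threeCycleLayout_layoutPerm τ s).map_a i⟩
    · rintro ⟨i, hi⟩
      have := (threeCycleLayout_layoutPerm τ s).map_a (τ.symm i)
      rw [Equiv.apply_symm_apply, hi] at this
      exact ⟨_, (Fin.natAdd_injective _ m this).symm⟩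
  have hs : s = s' := OrderEmbedding.range_inj.1 (by rw [hr τ s, hr τ' s', h])
  subst hs
  refine Prod.ext (Equiv.ext fun i => Fin.castAdd_injective m (m + m) ?_) rfl
  have h1 := (threeCycleLayout_layoutPerm τ s).map_t i
  rw [h, (threeCycleLayout_layoutPerm τ' s).map_t i] at h1
  exact h1.symm

variable {τ}

/-- The layouts that avoid `132` are counted by block maps. -/
theorem avoids_layoutPerm_iff (hτ : Avoids τ pattern132) :
    Avoids (layoutPerm τ s) pattern132 ↔
      orderEmbeddingEquivOrderHom m m s ∈ blockMaps (rightToLeftMaxima τ) := by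
  set g := orderEmbeddingEquivOrderHom m m s with hg
  have hgs : ∀ i, (g i : ℕ) + i = s i := fun i => by
    rw [hg, orderEmbeddingEquivOrderHom_apply_val]
    exact Nat.sub_add_cancel (val_le_of_orderEmbedding s i)
  have hts : ∀ l j, complEmb s l < s j ↔ (l : ℕ) < g j := fun l j => by
    rw [complEmb_lt_iff, ← hgs]; omega
  have hst : ∀ l j, s j < complEmb s l ↔ (g j : ℕ) ≤ l := fun l j => by
    rw [← not_lt, ← hts, not_lt]
    exact ⟨le_of_lt, fun h => lt_of_le_of_ne h (complEmb_ne s j l)⟩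
  have hgm : ∀ {i j}, i ≤ j → (g i : ℕ) ≤ g j := fun h => g.monotone h
  rw [(threeCycleLayout_layoutPerm τ s).avoids_iff]
  simp only [hτ, true_and, (Fin.strictMono_natAdd m).lt_iff_lt, hts, hst]
  constructor
  · intro h
    have hconst : ∀ i j, i < j → τ i < τ j → (g i : ℕ) = g j := by
      intro i j hij hτij
      refine le_antisymm (hgm hij.le) (not_lt.1 fun hlt => ?_)
      -- The element of `t` with index `g i` is the first one above `s i`; if `g i < g j`, it lies
      -- below `s j`.
      exact (h i j hij hτij ⟨g i, hlt.trans_le (Nat.le_of_lt_succ (g j).2)⟩).1 ⟨le_rfl, hlt⟩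
    have hnot : ∀ i, i ∉ rightToLeftMaxima τ → ∃ j, i < j ∧ τ i < τ j := by
      intro i hi
      rw [mem_rightToLeftMaxima] at hi
      push Not at hi
      obtain ⟨j, hij, hτij⟩ := hi
      exact ⟨j, hij, lt_of_le_of_ne hτij fun e => hij.ne (τ.injective e)⟩
    refine ⟨?_, fun l => ?_⟩
    · have key : ∀ d : ℕ, ∀ i j : Fin m, (j : ℕ) - i ≤ d → i ≤ j →
          (∀ v ∈ rightToLeftMaxima τ, i ≤ v → j ≤ v) → (g j : ℕ) ≤ g i := by
        intro d
        induction d with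
        | zero =>
          intro i j hd _ _
          exact hgm (Nat.sub_eq_zero_iff_le.1 (Nat.le_zero.1 hd))
        | succ d ih =>
          intro i j hd hij hv
          rcases hij.eq_or_lt with rfl | hij
          · exact le_rfl
          obtain ⟨k, hik, hτik⟩ := hnot i fun hi => (hv i hi le_rfl).not_gt hij
          rw [hconst i k hik hτik]
          rcases le_total j k with hjk | hkj
          · exact hgm hjk
          · refine ih k j ?_ hkj fun v hvV hkv => hv v hvV (hik.le.trans hkv)
            have : (i : ℕ) < k := hik
            omega
      intro i j hij hv
      exact Fin.ext (le_antisymm (hgm hij) (key _ i j le_rfl hij hv))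
    · rcases Fin.eq_zero_or_eq_succ (g l) with h0 | ⟨v, hv⟩
      · rw [h0]; exact mem_insert_self _ _
      · rw [hv]
        refine mem_insert_of_mem (mem_image_of_mem _ ?_)
        by_contra hvV
        obtain ⟨j, hvj, hτvj⟩ := hnot v hvV
        -- As `g l = v + 1`, the point `s l` lies directly after `t v` among the `t`'s, hence
        -- between `t v` and `t j`.
        refine (h v j hvj hτvj l).2 ⟨?_, ?_⟩ <;> rw [hv, Fin.val_succ]
        · exact Nat.lt_succ_self _
        · exact hvj
  · rintro ⟨h1, h2⟩ i j hij hτij l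
    -- Positions `i < j` with `τ i < τ j` share a block: a right-to-left maximum `v` with `i < v <
    -- j` would make `i, v, j` a `132`.
    have hV : ∀ v ∈ rightToLeftMaxima τ, i ≤ v → j ≤ v := by
      intro v hv hiv
      by_contra hvj
      rw [not_le] at hvj
      have hτv := mem_rightToLeftMaxima.1 hv j hvj
      rcases hiv.eq_or_lt with rfl | hiv
      · exact lt_asymm hτij hτv
      · exact avoids_pattern132_iff.1 hτ i v j hiv hvj hτij hτv
    constructor
    · rintro ⟨h3, h4⟩
      rw [h1 i j hij.le hV] at h3
      omega
    · rintro ⟨h3, h4⟩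
      rcases mem_insert.1 (h2 l) with h0 | hl
      · rw [h0] at h3
        exact absurd h3 (Nat.not_lt_zero _)
      · obtain ⟨v, hv, hvl⟩ := mem_image.1 hl
        rw [← hvl, Fin.val_succ] at h3 h4
        have : (j : ℕ) ≤ v := hV v hv (Nat.lt_succ_iff.1 h3)
        omega

theorem card_avoids_layoutPerm (hτ : Avoids τ pattern132) :
    Nat.card {s : Fin m ↪o Fin (m + m) // Avoids (layoutPerm τ s) pattern132} =
      Nat.centralBinom (rightToLeftMaxima τ).card := by
  have hV : ∀ i, ∃ v ∈ rightToLeftMaxima τ, i ≤ v := fun i => by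
    refine ⟨⟨m - 1, by have := i.pos; omega⟩, mem_rightToLeftMaxima.2 fun j hj => ?_,
      Nat.le_sub_one_of_lt i.2⟩
    have : m - 1 < (j : ℕ) := hj
    omega
  rw [← card_blockMaps hV]
  exact Nat.card_congr ((orderEmbeddingEquivOrderHom m m).subtypeEquiv fun s =>
    avoids_layoutPerm_iff s hτ)

end layoutPerm

/-! ### Every `132`-avoider with only `3`-cycles is a layout -/

/-- The least elements of the cycles of a permutation whose cycles have length `3`. -/
def cycleMinima {n : ℕ} (π : Equiv.Perm (Fin n)) : Finset (Fin n) :=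
  univ.filter fun x => x < π x ∧ x < π (π x)

theorem mem_cycleMinima {n : ℕ} {π : Equiv.Perm (Fin n)} {x : Fin n} :
    x ∈ cycleMinima π ↔ x < π x ∧ x < π (π x) := by
  simp [cycleMinima]

theorem cycleMinima_cover {n : ℕ} {π : Equiv.Perm (Fin n)}
    (hπ : ∀ x, π (π (π x)) = x ∧ π x ≠ x) (x : Fin n) :
    x ∈ cycleMinima π ∨ π x ∈ cycleMinima π ∨ π (π x) ∈ cycleMinima π := by
  simp only [mem_cycleMinima, (hπ x).1]
  have h1 := (hπ x).2
  have h2 := (hπ (π x)).2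
  have h3 := (hπ (π (π x))).2
  rw [(hπ x).1] at h3
  omega

theorem apply_notMem_cycleMinima {n : ℕ} {π : Equiv.Perm (Fin n)}
    (hπ : ∀ x, π (π (π x)) = x ∧ π x ≠ x) {x : Fin n} (hx : x ∈ cycleMinima π) :
    π x ∉ cycleMinima π ∧ π (π x) ∉ cycleMinima π := by
  simp only [mem_cycleMinima, (hπ x).1] at hx ⊢
  exact ⟨fun h => lt_asymm hx.1 h.2, fun h => lt_asymm hx.2 h.1⟩

theorem eq_card_cycleMinima {n : ℕ} {π : Equiv.Perm (Fin n)}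
    (hπ : ∀ x, π (π (π x)) = x ∧ π x ≠ x) :
    n = (cycleMinima π).card + ((cycleMinima π).card + (cycleMinima π).card) := by
  set M := cycleMinima π with hM
  have hu : univ = M.disjUnion ((M.map π.toEmbedding).disjUnion
      ((M.map π.toEmbedding).map π.toEmbedding) (by
        rw [disjoint_left]
        intro x hx hx'
        obtain ⟨y, hy, rfl⟩ := mem_map.1 hx
        obtain ⟨z, hz, hzy⟩ := mem_map.1 hx'
        obtain ⟨w, hw, rfl⟩ := mem_map.1 hz
        have : π w = y := π.injective hzy
        exact (apply_notMem_cycleMinima hπ hw).1 (this ▸ hy))) (by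
        rw [disjoint_left]
        intro x hx hx'
        rcases mem_disjUnion.1 hx' with h | h
        · obtain ⟨y, hy, rfl⟩ := mem_map.1 h
          exact (apply_notMem_cycleMinima hπ hy).1 hx
        · obtain ⟨z, hz, rfl⟩ := mem_map.1 h
          obtain ⟨w, hw, rfl⟩ := mem_map.1 hz
          exact (apply_notMem_cycleMinima hπ hw).2 hx) := by
    symm
    rw [eq_univ_iff_forall]
    intro x
    rw [mem_disjUnion, mem_disjUnion]
    rcases cycleMinima_cover hπ x with h | h | h
    · exact Or.inl h
    · refine Or.inr (Or.inr (mem_map.2 ⟨_, mem_map_of_mem _ h, ?_⟩))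
      exact (hπ x).1
    · refine Or.inr (Or.inl (mem_map.2 ⟨_, h, ?_⟩))
      exact (hπ x).1
  have := congrArg card hu
  rwa [card_disjUnion, card_disjUnion, card_map, card_map, card_map, card_univ,
    Fintype.card_fin] at this

/-- Let `j` be a cycle minimum and `i < j` not. If `π i < i`, the positions `i, j, π (π j)` carry `π
i, π j, j`, a `132`. If `π (π i) < i`, the positions `π (π i), j, π (π j)` carry `i, π j, j`, again
a `132`. -/
theorem isLowerSet_cycleMinima {n : ℕ} {π : Equiv.Perm (Fin n)}
    (hπ : ∀ x, π (π (π x)) = x ∧ π x ≠ x) (hav : Avoids π pattern132) :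
    IsLowerSet (cycleMinima π : Set (Fin n)) := by
  rw [avoids_pattern132_iff] at hav
  intro j i hij hj
  rw [mem_coe] at hj ⊢
  rcases hij.eq_or_lt with rfl | hij
  · exact hj
  by_contra hi
  rw [mem_cycleMinima] at hi hj
  have h1 := (hπ i).2
  have h2 := (hπ (π (π i))).2
  rw [(hπ i).1] at h2
  have h3 : π i < i ∨ π (π i) < i := by omega
  rcases h3 with h3 | h3
  · refine hav i j (π (π j)) hij hj.2 ?_ ?_ <;> rw [(hπ j).1]
    · exact h3.trans hij
    · exact hj.1
  · refine hav (π (π i)) j (π (π j)) (h3.trans hij) hj.2 ?_ ?_ <;> rw [(hπ j).1]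
    · rwa [(hπ i).1]
    · exact hj.1

theorem exists_layoutPerm_eq {m : ℕ} {π : Equiv.Perm (Fin (m + (m + m)))}
    (hπ : ∀ x, π (π (π x)) = x ∧ π x ≠ x) (hav : Avoids π pattern132) :
    ∃ τ s, layoutPerm τ s = π := by
  have hMcard : (cycleMinima π).card = m := by
    have := eq_card_cycleMinima hπ
    omega
  have hM : ∀ x, x ∈ cycleMinima π ↔ (x : ℕ) < m := fun x => by
    rw [mem_iff_lt_card_of_isLowerSet (isLowerSet_cycleMinima hπ hav), hMcard]
  have hlt : ∀ x : Fin (m + (m + m)), (x : ℕ) < m → m ≤ (π x : ℕ) ∧ m ≤ (π (π x) : ℕ) := by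
    intro x hx
    have := apply_notMem_cycleMinima hπ ((hM x).2 hx)
    rwa [hM, hM, not_lt, not_lt] at this
  have hge : ∀ x : Fin (m + (m + m)), m ≤ (x : ℕ) → (π x : ℕ) < m ∨ (π (π x) : ℕ) < m := by
    intro x hx
    have := cycleMinima_cover hπ x
    rw [hM, hM, hM] at this
    omega
  have hsub : ∀ x : Fin (m + (m + m)), m ≤ (x : ℕ) → ∃ y, x = Fin.natAdd m y := fun x hx =>
    ⟨⟨x - m, by omega⟩, Fin.ext (by simp [hx])⟩
  let S : Finset (Fin (m + m)) := univ.filter fun y => (π (π (Fin.natAdd m y)) : ℕ) < m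
  have hSM : S.map (Fin.natAddEmb m) = (cycleMinima π).map π.toEmbedding := by
    ext x
    rw [mem_map_equiv, hM, mem_map]
    have hsymm : π.symm x = π (π x) := by rw [Equiv.symm_apply_eq, (hπ x).1]
    rw [hsymm]
    constructor
    · rintro ⟨y, hy, rfl⟩
      exact (mem_filter.1 hy).2
    · intro hx
      have := (hlt _ hx).1
      rw [(hπ x).1] at this
      obtain ⟨y, rfl⟩ := hsub x this
      exact ⟨y, mem_filter.2 ⟨mem_univ _, hx⟩, rfl⟩
  have hS : S.card = m := by
    rw [← card_map (Fin.natAddEmb m), hSM, card_map, hMcard]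
  let s := S.orderEmbOfFin hS
  have hs : ∀ y, y ∈ Set.range s ↔ (π (π (Fin.natAdd m y)) : ℕ) < m := fun y => by
    rw [range_orderEmbOfFin]
    simp [S]
  have hs' : ∀ i, (π (π (Fin.natAdd m (s i))) : ℕ) < m := fun i => (hs _).1 ⟨i, rfl⟩
  have hsπ : ∀ i, m ≤ (π (Fin.natAdd m (s i)) : ℕ) := fun i => by
    have := (hlt _ (hs' i)).2
    rwa [(hπ _).1] at this
  -- For a descent `π w < π u` with `u < w`, the values at `π (π u), u, w` form a `132` if `u < π
  -- w`, and those at `π w, u, w` do if `π w < u`. Equality fails because `π u` is not a cycle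
  -- minimum while `π (π w)` is.
  have hmono : StrictMono fun i => π (Fin.natAdd m (s i)) := by
    intro i j hij
    have huw : Fin.natAdd m (s i) < Fin.natAdd m (s j) :=
      Fin.strictMono_natAdd m (s.strictMono hij)
    have hmu : m ≤ (Fin.natAdd m (s i) : ℕ) := Nat.le_add_right _ _
    have h1 := hs' i
    have h2 := hs' j
    have h3 := hsπ i
    have h4 := hsπ j
    dsimp only
    generalize Fin.natAdd m (s i) = u at *
    generalize Fin.natAdd m (s j) = w at *
    rw [avoids_pattern132_iff] at hav
    by_contra hnot
    have hne : π w ≠ π u := fun e => huw.ne' (π.injective e)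
    have hwu : π w < π u := lt_of_le_of_ne (not_lt.1 hnot) hne
    rcases lt_trichotomy u (π w) with h | h | h
    · refine hav (π (π u)) u w (Fin.lt_def.2 (by omega)) huw ?_ hwu
      rwa [(hπ u).1]
    · rw [h] at h3
      omega
    · exact hav (π w) u w h huw (Fin.lt_def.2 (by omega)) hwu
  -- Two strictly increasing sequences with the same range coincide.
  have hrange : ∀ i, Fin.natAdd m (complEmb s i) = π (Fin.natAdd m (s i)) := by
    refine congrFun ((StrictMono.range_inj
      ((Fin.strictMono_natAdd m).comp (complEmb s).strictMono) hmono).1 ?_)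
    ext x
    constructor
    · rintro ⟨i, rfl⟩
      have hi : complEmb s i ∉ Set.range s := by
        rintro ⟨j, hj⟩
        exact complEmb_ne s j i hj
      rw [hs] at hi
      dsimp only [Function.comp_apply]
      have h1 : (π (Fin.natAdd m (complEmb s i)) : ℕ) < m :=
        (hge _ (Nat.le_add_right _ _)).resolve_right hi
      obtain ⟨y, hy⟩ := hsub (π (π (Fin.natAdd m (complEmb s i)))) (not_lt.1 hi)
      have hyS : y ∈ Set.range s := by rw [hs, ← hy, (hπ _).1]; exact h1
      obtain ⟨j, rfl⟩ := hyS
      exact ⟨j, by dsimp only; rw [← hy, (hπ _).1]⟩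
    · rintro ⟨i, rfl⟩
      dsimp only
      obtain ⟨y, hy⟩ := hsub _ (hsπ i)
      rw [hy]
      rcases exists_eq_or_complEmb s y with ⟨j, rfl⟩ | ⟨j, rfl⟩
      · have := hs' j
        rw [← hy, (hπ _).1, Fin.val_natAdd] at this
        omega
      · exact ⟨j, rfl⟩
  let τ : Equiv.Perm (Fin m) := Equiv.ofBijective (fun i => ⟨π (π (Fin.natAdd m (s i))), hs' i⟩) <|
    Finite.injective_iff_bijective.1 fun i j h => by
      have := Fin.ext (Fin.mk.inj h)
      exact s.injective (Fin.natAdd_injective _ m (π.injective (π.injective this)))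
  have hτ : ∀ i, Fin.castAdd (m + m) (τ i) = π (π (Fin.natAdd m (s i))) := fun i => rfl
  refine ⟨τ, s, Equiv.ext fun x => ?_⟩
  have hl := threeCycleLayout_layoutPerm τ s
  rcases hl.cover x with ⟨i, rfl⟩ | ⟨i, rfl⟩ | ⟨i, rfl⟩
  · rw [hl.map_a, hτ, (hπ _).1]
  · rw [hl.map_s, hrange]
  · rw [hl.map_t, hrange, hτ]

/-! ### The count as a sum over ballot numbers, and the conclusion -/

theorem avoidCount_of_not_dvd {n : ℕ} (hn : ¬ 3 ∣ n) : avoidCount {3} pattern132 n = 0 := by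
  have : IsEmpty {π : Equiv.Perm (Fin n) // CycleLengthsIn {3} π ∧ Avoids π pattern132} :=
    ⟨fun π => hn <| by
      have := eq_card_cycleMinima (cycleLengthsIn_three_iff.1 π.2.1)
      omega⟩
  exact Nat.card_of_isEmpty

open Classical in
theorem avoidCount_three_mul (m : ℕ) : avoidCount {3} pattern132 (3 * m) =
    ∑ k ∈ range (m + 1), Nat.centralBinom k * rlmCount k m := by
  have hm : 3 * m = m + (m + m) := by omega
  rw [hm, avoidCount]
  have e : {x : Equiv.Perm (Fin m) × (Fin m ↪o Fin (m + m)) //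
      Avoids (layoutPerm x.1 x.2) pattern132} ≃
      {π : Equiv.Perm (Fin (m + (m + m))) // CycleLengthsIn {3} π ∧ Avoids π pattern132} :=
    Equiv.ofBijective (fun x => ⟨layoutPerm x.1.1 x.1.2,
      (threeCycleLayout_layoutPerm x.1.1 x.1.2).cycleLengthsIn, x.2⟩) <| by
      constructor
      · intro x y h
        exact Subtype.ext (layoutPerm_injective (Subtype.mk.inj h))
      · rintro ⟨π, hπ, hav⟩
        obtain ⟨τ, s, rfl⟩ := exists_layoutPerm_eq (cycleLengthsIn_three_iff.1 hπ) hav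
        exact ⟨⟨(τ, s), hav⟩, rfl⟩
  rw [← Nat.card_congr e, Nat.card_congr (Equiv.subtypeProdEquivSigmaSubtype
    fun τ s => Avoids (layoutPerm τ s) pattern132), Nat.card_sigma]
  have h1 : ∀ τ : Equiv.Perm (Fin m),
      Nat.card {s : Fin m ↪o Fin (m + m) // Avoids (layoutPerm τ s) pattern132} =
        if Avoids τ pattern132 then Nat.centralBinom (rightToLeftMaxima τ).card else 0 := by
    intro τ
    split_ifs with hτ
    · exact card_avoids_layoutPerm hτ
    · have : IsEmpty {s : Fin m ↪o Fin (m + m) // Avoids (layoutPerm τ s) pattern132} :=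
        ⟨fun s => hτ ((threeCycleLayout_layoutPerm τ s.1).avoids_iff.1 s.2).1⟩
      exact Nat.card_of_isEmpty
  simp only [h1]
  rw [← sum_filter, ← sum_fiberwise_of_maps_to (t := range (m + 1))
    (g := fun τ => (rightToLeftMaxima τ).card)]
  · refine sum_congr rfl fun k _ => ?_
    rw [filter_filter, rlmCount, sum_congr rfl fun τ hτ => by
      rw [(mem_filter.1 hτ).2.2], sum_const, smul_eq_mul, mul_comm]
  · intro τ _
    have := card_le_univ (rightToLeftMaxima τ)
    rw [Fintype.card_fin] at this
    exact mem_range.2 (Nat.lt_succ_of_le this)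

end PatternCycles

theorem mainTheorem4 :
    PatternCycles.avoidSeries {3} PatternCycles.pattern132 =
      1 + 2 * (PatternCycles.catalanCubed - 1) *
        (PatternCycles.motzkinSeriesAt 2).subst (PatternCycles.catalanCubed - 1) := by
  refine PatternCycles.eq_of_ballot_sum PatternCycles.coeff_X_mul_catalanGF_pow_eq_rlmCount
    (fun m => ?_) fun n hn => ?_
  · rw [PatternCycles.avoidSeries, PowerSeries.coeff_mk, PatternCycles.avoidCount_three_mul]
    push_cast
    rfl
  · rw [PatternCycles.avoidSeries, PowerSeries.coeff_mk,
      PatternCycles.avoidCount_of_not_dvd hn, Nat.cast_zero]
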